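/- Let $k,n\ge 0$ be integers and let $S_{k,n}$ be the set of injections from $[k]=\{1,\dots,k\}$ to $[n]=\{1,\dots,n\}$. Then $$|S_{k,n}|=\sum_{\mu,\lambda} f^{\mu}f^{\lambda},$$ where the sum runs over all pairs of partitions $\mu\vdash k$, $\lambda\vdash n$ such that $\lambda/\mu$ is a horizontal strip, that is, the Young diagram of $\mu$ is contained in that of $\lambda$ and no two distinct cells of $\lambda$ outside $\mu$ lie in the same column. Here $f^{\mu}$ denotes the number of standard Young tableaux of shape $\mu$, that is, of bijective labellings of the cells of the diagram of $\mu\vdash m$ by $1,\dots,m$ that increase from left to right along each row and from top to bottom along each column. Moreover, if $k\le n$, then $|S_{k,n}|=\dfrac{n!}{(n-k)!}$. -/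

import Mathlib

namespace YoungDiagram

theorem finite_setOf_card_eq (n : ℕ) : {μ : YoungDiagram | μ.card = n}.Finite := by
  have hinj : Function.Injective YoungDiagram.cells := fun μ ν h => YoungDiagram.ext h
  refine Set.Finite.of_finite_image (f := YoungDiagram.cells) ?_ hinj.injOn
  refine Set.Finite.subset
    (Finset.finite_toSet (Finset.range n ×ˢ Finset.range n).powerset) ?_
  rintro s ⟨μ, hμ, rfl⟩
  have hμ' : μ.cells.card = n := hμ
  simp only [Finset.coe_powerset, Set.mem_preimage, Set.mem_powerset_iff, Finset.coe_subset]
  rintro ⟨i, j⟩ hc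
  have hc' : (i, j) ∈ μ := hc
  have h1 : (Finset.range (i + 1)).card ≤ μ.cells.card :=
    Finset.card_le_card_of_injOn (fun a => (a, j))
      (fun a ha => μ.up_left_mem (Nat.lt_succ_iff.mp (by simpa using ha)) le_rfl hc')
      (fun a _ b _ h => (Prod.ext_iff.mp h).1)
  have h2 : (Finset.range (j + 1)).card ≤ μ.cells.card :=
    Finset.card_le_card_of_injOn (fun b => (i, b))
      (fun b hb => μ.up_left_mem le_rfl (Nat.lt_succ_iff.mp (by simpa using hb)) hc')
      (fun a _ b _ h => (Prod.ext_iff.mp h).2)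
  simp only [Finset.card_range] at h1 h2
  simp only [Finset.mem_product, Finset.mem_range]
  omega

/-- The (finite) set of partitions `μ ⊢ n`, each given by its Young diagram: cell `(i, j)` is the
one in row `i` and column `j`, and the lengths of the rows are the parts of the partition. -/
noncomputable def partitionsOf (n : ℕ) : Finset YoungDiagram :=
  (finite_setOf_card_eq n).toFinset

theorem mem_partitionsOf {n : ℕ} {μ : YoungDiagram} : μ ∈ partitionsOf n ↔ μ.card = n := by
  simp [partitionsOf]

/-- A standard Young tableau of shape `μ ⊢ n`: a bijective labelling of the cells of `μ` by the
`n`-element chain `Fin n`, increasing from left to right in each row and from top to bottom in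
each column. -/
structure StandardTableau (μ : YoungDiagram) where
  entry : {c : ℕ × ℕ // c ∈ μ.cells} ≃ Fin μ.card
  row_strict : ∀ c d : {c : ℕ × ℕ // c ∈ μ.cells},
    c.1.1 = d.1.1 → c.1.2 < d.1.2 → entry c < entry d
  col_strict : ∀ c d : {c : ℕ × ℕ // c ∈ μ.cells},
    c.1.2 = d.1.2 → c.1.1 < d.1.1 → entry c < entry d

instance (μ : YoungDiagram) : Finite (StandardTableau μ) :=
  Finite.of_injective StandardTableau.entry (by rintro ⟨a, _, _⟩ ⟨b, _, _⟩ h; cases h; rfl)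

/-- The number `f^μ` of standard Young tableaux of shape `μ`. -/
noncomputable def numStandardTableaux (μ : YoungDiagram) : ℕ :=
  Nat.card (StandardTableau μ)

/-- `lam / μ` is a horizontal strip: `μ` is contained in `lam`, and no two distinct cells of `lam`
outside `μ` lie in the same column. -/
def IsHorizontalStrip (μ lam : YoungDiagram) : Prop :=
  μ.cells ⊆ lam.cells ∧
    ∀ c ∈ lam.cells \ μ.cells, ∀ d ∈ lam.cells \ μ.cells, c.2 = d.2 → c = d

instance (μ lam : YoungDiagram) : Decidable (IsHorizontalStrip μ lam) := by
  unfold IsHorizontalStrip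
  infer_instance

end YoungDiagram

namespace YoungDiagram

open Finset

/-! Let P(k,n) be the right-hand sum (`stripPairCount`). It satisfies the recurrence of the falling
factorial, P(k+1,n+1) = (k+1) P(k,n) + P(k+1,n), with the same initial values. The source is a
commutation relation in Young's lattice (`ncard_above_eq_ncard_below_add`). Fix μ and ρ: the λ
covering ρ with λ/μ a horizontal strip are as many as the ν covered by μ with ρ/ν a horizontal
strip, plus one if ρ/μ is itself a strip. In row lengths, being a strip means interlacing, and the
relation compares adding a cell to ρ with removing one from μ. Weighting by f^ρ and using the
branching rule, that f^λ is the sum of f^ρ over the ρ covered by λ (`numStandardTableaux_eq_sum`),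
turns this into the recurrence. The factor k+1 is the sum of f^λ over the λ covering ν ⊢ k, divided
by f^ν (`sum_cover_numStandardTableaux`). -/

/-! ### Row lengths, interlacing and one-cell extensions. -/

theorem le_iff_rowLen_le {μ ν : YoungDiagram} : μ ≤ ν ↔ ∀ i, μ.rowLen i ≤ ν.rowLen i := by
  constructor
  · intro h i
    by_contra! hlt
    exact absurd (mem_iff_lt_rowLen.1 (h (mem_iff_lt_rowLen.2 hlt))) (lt_irrefl _)
  · rintro h ⟨i, j⟩ hc
    exact mem_iff_lt_rowLen.2 ((mem_iff_lt_rowLen.1 hc).trans_le (h i))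

theorem rowLen_injective : Function.Injective YoungDiagram.rowLen := fun _ _ h =>
  le_antisymm (le_iff_rowLen_le.2 fun i => (congrFun h i).le)
    (le_iff_rowLen_le.2 fun i => (congrFun h i).ge)

/-- The sequences `a`, `b` interlace: `a 0 ≥ b 0 ≥ a 1 ≥ b 1 ≥ ⋯`. -/
def Interlace (a b : ℕ → ℕ) : Prop := ∀ j, b j ≤ a j ∧ a (j + 1) ≤ b j

theorem Interlace.antitone_left {a b : ℕ → ℕ} (h : Interlace a b) : Antitone a :=
  antitone_nat_of_succ_le fun j => (h j).2.trans (h j).1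

theorem Interlace.antitone_right {a b : ℕ → ℕ} (h : Interlace a b) : Antitone b :=
  antitone_nat_of_succ_le fun j => (h (j + 1)).1.trans (h j).2

theorem isHorizontalStrip_iff_interlace {μ lam : YoungDiagram} :
    IsHorizontalStrip μ lam ↔ Interlace lam.rowLen μ.rowLen := by
  unfold IsHorizontalStrip Interlace
  rw [cells_subset_iff, le_iff_rowLen_le, forall_and]
  refine and_congr_right fun hle => ⟨fun h j => ?_, fun h => ?_⟩
  -- Otherwise column `μ.rowLen j` contains two cells of the strip, in rows `j` and `j + 1`.
  · by_contra! hlt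
    have h1 : (j + 1, μ.rowLen j) ∈ lam := mem_iff_lt_rowLen.2 hlt
    have h2 : (j, μ.rowLen j) ∈ lam := lam.up_left_mem (Nat.le_succ j) le_rfl h1
    have h3 : (j, μ.rowLen j) ∉ μ := fun h => (mem_iff_lt_rowLen.1 h).ne rfl
    have h4 : (j + 1, μ.rowLen j) ∉ μ := fun h => h3 (μ.up_left_mem (Nat.le_succ j) le_rfl h)
    have := h (j + 1, μ.rowLen j) (by simp [h1, h4]) (j, μ.rowLen j) (by simp [h2, h3]) rfl
    simp at this
  · rintro ⟨i, j⟩ hc ⟨i', j'⟩ hd (rfl : j = j')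
    simp only [mem_sdiff, mem_cells, mem_iff_lt_rowLen, not_lt] at hc hd
    rcases lt_trichotomy i i' with hlt | rfl | hlt
    · have := lam.rowLen_anti (_ + 1) _ hlt
      have := h i
      omega
    · rfl
    · have := lam.rowLen_anti (_ + 1) _ hlt
      have := h i'
      omega

theorem exists_rowLen_eq {f : ℕ → ℕ} (hf : Antitone f) {N : ℕ} (hN : f N = 0) :
    ∃ μ : YoungDiagram, μ.rowLen = f := by
  obtain ⟨μ, hμ⟩ : ∃ μ : YoungDiagram,
      μ.cells = {c ∈ range N ×ˢ range (f 0) | c.2 < f c.1} := by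
    refine ⟨⟨{c ∈ range N ×ˢ range (f 0) | c.2 < f c.1}, ?_⟩, rfl⟩
    rintro ⟨i, j⟩ ⟨i', j'⟩ ⟨hi : i' ≤ i, hj : j' ≤ j⟩ h
    simp only [coe_filter, mem_product, mem_range, Set.mem_ofPred_eq] at h ⊢
    have := hf hi
    omega
  refine ⟨μ, funext fun i => eq_of_forall_lt_iff fun j => ?_⟩
  rw [← mem_iff_lt_rowLen, ← mem_cells, hμ]
  simp only [mem_filter, mem_product, mem_range, and_iff_right_iff_imp]
  intro h
  have h0 := hf (Nat.zero_le i)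
  refine ⟨?_, by omega⟩
  by_contra! hi
  have := hf hi
  omega

theorem rowLen_colLen_zero (μ : YoungDiagram) : μ.rowLen (μ.colLen 0) = 0 := by
  by_contra h
  exact absurd (mem_iff_lt_colLen.1 (mem_iff_lt_rowLen.2 (Nat.pos_of_ne_zero h))) (lt_irrefl _)

theorem rowLen_pos_iff {μ : YoungDiagram} {i : ℕ} : 0 < μ.rowLen i ↔ i < μ.colLen 0 := by
  rw [← mem_iff_lt_rowLen, mem_iff_lt_colLen]

theorem exists_cells_eq_insert {ν lam : YoungDiagram} (h : ν ≤ lam)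
    (hc : ν.card + 1 = lam.card) : ∃ c, c ∉ ν ∧ lam.cells = insert c ν.cells := by
  have h' := cells_subset_iff.2 h
  have : (lam.cells \ ν.cells).card = 1 := by
    rw [card_sdiff_of_subset h']
    change lam.card - ν.card = 1
    omega
  obtain ⟨c, hc⟩ := card_eq_one.1 this
  have hm : c ∈ lam.cells \ ν.cells := by simp [hc]
  refine ⟨c, (mem_sdiff.1 hm).2, ?_⟩
  rw [← sdiff_union_of_subset h', hc]
  rfl

theorem le_and_card_iff_rowLen {ν lam : YoungDiagram} : ν ≤ lam ∧ ν.card + 1 = lam.card ↔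
    ∃ i, lam.rowLen = Function.update ν.rowLen i (ν.rowLen i + 1) := by
  constructor
  · rintro ⟨h, hc⟩
    obtain ⟨⟨i, j⟩, hn, hins⟩ := exists_cells_eq_insert h hc
    have hm : ∀ a b, (a, b) ∈ lam ↔ (a = i ∧ b = j) ∨ (a, b) ∈ ν := fun a b => by
      rw [← mem_cells, hins]; simp
    have hle := le_iff_rowLen_le.1 h
    simp only [mem_iff_lt_rowLen] at hm hn
    refine ⟨i, funext fun a => ?_⟩
    rw [Function.update_apply]
    -- Row lengths are compared by testing the last cell of a row of `lam` and the first cell beyond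
    -- a row of `ν`.
    have h1 := hm a (lam.rowLen a - 1)
    have h2 := hm a (ν.rowLen a)
    have h3 := hm i j
    have h4 := hm i (ν.rowLen i)
    have h5 := hle a
    split_ifs with ha
    · subst ha; omega
    · omega
  · rintro ⟨i, hi⟩
    have hcells : lam.cells = insert (i, ν.rowLen i) ν.cells := by
      ext ⟨a, b⟩
      rw [mem_insert, mem_cells, mem_cells, mem_iff_lt_rowLen, mem_iff_lt_rowLen, hi,
        Function.update_apply, Prod.mk.injEq]
      split_ifs with ha
      · subst ha; omega
      · simp [ha]
    refine ⟨cells_subset_iff.1 (hcells ▸ subset_insert _ _), ?_⟩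
    change _ = lam.cells.card
    rw [hcells, card_insert_of_notMem]
    rw [mem_cells, mem_iff_lt_rowLen]
    exact lt_irrefl _

theorem isHorizontalStrip_iff_le_of_card {ν lam : YoungDiagram} (hc : ν.card + 1 = lam.card) :
    IsHorizontalStrip ν lam ↔ ν ≤ lam := by
  refine ⟨fun h => cells_subset_iff.1 h.1, fun h => ⟨cells_subset_iff.2 h, ?_⟩⟩
  obtain ⟨c, hn, hins⟩ := exists_cells_eq_insert h hc
  intro a ha b hb _
  simp only [hins, mem_sdiff, mem_insert] at ha hb
  rw [ha.1.resolve_right ha.2, hb.1.resolve_right hb.2]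

/-! ### The commutation relation between covers and horizontal strips. -/

/-- Interlacing forces both sequences to be antitone, so the lengthened sequence is a partition
without a separate check that the cell can be added. -/
theorem ncard_above_eq (μ ρ : YoungDiagram) :
    {lam : YoungDiagram | (ρ ≤ lam ∧ ρ.card + 1 = lam.card) ∧ IsHorizontalStrip μ lam}.ncard =
      {i | Interlace (Function.update ρ.rowLen i (ρ.rowLen i + 1)) μ.rowLen}.ncard := by
  symm
  have hex : ∀ i, Interlace (Function.update ρ.rowLen i (ρ.rowLen i + 1)) μ.rowLen →
      ∃ lam : YoungDiagram, lam.rowLen = Function.update ρ.rowLen i (ρ.rowLen i + 1) := fun i hi =>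
    exists_rowLen_eq hi.antitone_left (N := max (i + 1) (ρ.colLen 0)) (by
      rw [Function.update_of_ne (by omega)]
      have := ρ.rowLen_anti _ _ (le_max_right (i + 1) (ρ.colLen 0))
      rw [rowLen_colLen_zero] at this
      omega)
  choose g hg using hex
  refine Set.ncard_congr g ?_ ?_ ?_
  · intro i hi
    exact ⟨le_and_card_iff_rowLen.2 ⟨i, hg i hi⟩, by
      rw [isHorizontalStrip_iff_interlace, hg i hi]; exact hi⟩
  · intro i j hi hj h
    have := congrFun ((hg i hi).symm.trans ((congrArg rowLen h).trans (hg j hj))) i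
    by_contra hne
    simp [hne] at this
  · rintro lam ⟨h1, h2⟩
    obtain ⟨i, hi⟩ := le_and_card_iff_rowLen.1 h1
    rw [isHorizontalStrip_iff_interlace, hi] at h2
    exact ⟨i, h2, rowLen_injective ((hg i h2).trans hi.symm)⟩

theorem ncard_below_eq (μ ρ : YoungDiagram) :
    {ν : YoungDiagram | (ν ≤ μ ∧ ν.card + 1 = μ.card) ∧ IsHorizontalStrip ν ρ}.ncard =
      {i | 0 < μ.rowLen i ∧
        Interlace ρ.rowLen (Function.update μ.rowLen i (μ.rowLen i - 1))}.ncard := by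
  symm
  have hex : ∀ i, 0 < μ.rowLen i ∧
      Interlace ρ.rowLen (Function.update μ.rowLen i (μ.rowLen i - 1)) →
      ∃ ν : YoungDiagram, ν.rowLen = Function.update μ.rowLen i (μ.rowLen i - 1) := fun i hi =>
    exists_rowLen_eq hi.2.antitone_right (N := μ.colLen 0) (by
      rw [Function.update_of_ne (rowLen_pos_iff.1 hi.1).ne', rowLen_colLen_zero])
  choose g hg using hex
  refine Set.ncard_congr g ?_ ?_ ?_
  · intro i hi
    refine ⟨le_and_card_iff_rowLen.2 ⟨i, ?_⟩, by
      rw [isHorizontalStrip_iff_interlace, hg i hi]; exact hi.2⟩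
    rw [hg i hi, Function.update_idem, Function.update_self, Nat.sub_add_cancel hi.1,
      Function.update_eq_self]
  · intro i j hi hj h
    have := congrFun ((hg i hi).symm.trans ((congrArg rowLen h).trans (hg j hj))) i
    by_contra hne
    have hpos : 0 < μ.rowLen i := hi.1
    simp [hne] at this
    omega
  · rintro ν ⟨h1, h2⟩
    obtain ⟨i, hi⟩ := le_and_card_iff_rowLen.1 h1
    have hν : ν.rowLen = Function.update μ.rowLen i (μ.rowLen i - 1) := by
      rw [hi, Function.update_idem, Function.update_self, Nat.add_sub_cancel,
        Function.update_eq_self]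
    rw [isHorizontalStrip_iff_interlace, hν] at h2
    have hp : 0 < μ.rowLen i := by simp [hi]
    exact ⟨i, ⟨hp, h2⟩, rowLen_injective ((hg i ⟨hp, h2⟩).trans hν.symm)⟩

/-- Raising `a 0` never hurts. Raising `a (i + 1)` and lowering `b i` threaten the same inequality
`a (i + 1) ≤ b i`, and each is allowed exactly when it is strict. -/
theorem setOf_interlace_update_of_interlace {a b : ℕ → ℕ} (h : Interlace a b) :
    {i | Interlace (Function.update a i (a i + 1)) b} =
      insert 0 (Nat.succ '' {i | 0 < b i ∧ Interlace a (Function.update b i (b i - 1))}) := by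
  ext i
  simp only [Set.mem_insert_iff, Set.mem_image, Set.mem_ofPred_eq]
  rcases i with _ | i
  · simp only [true_or, iff_true]
    intro j
    have := h j
    simp only [Function.update_apply]
    grind
  · simp only [Nat.succ_eq_add_one, Nat.add_right_cancel_iff, exists_eq_right,
      Nat.add_eq_zero_iff, one_ne_zero, and_false, false_or]
    constructor
    · intro hi
      have h1 := (hi i).2
      rw [Function.update_self] at h1
      refine ⟨by omega, fun j => ?_⟩
      have := h j
      rw [Function.update_apply]
      split_ifs with hj
      · subst hj; omega
      · omega
    · rintro ⟨hpos, hi⟩ j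
      have h1 := (hi i).2
      rw [Function.update_self] at h1
      have := h j
      simp only [Function.update_apply]
      split_ifs with hj hj' hj'
      · omega
      · subst hj; omega
      · obtain rfl : j = i := by omega
        omega
      · omega

/-- Either move can repair only the inequality `b i ≤ a i`, and only by one unit. So the sole
violation is `b i = a i + 1`, and both moves cure it in the same row; monotonicity protects the
neighbouring inequalities. -/
theorem interlace_update_iff_of_not_interlace {a b : ℕ → ℕ} (ha : Antitone a) (hb : Antitone b)
    (h : ¬ Interlace a b) (i : ℕ) :
    Interlace (Function.update a i (a i + 1)) b ↔
      0 < b i ∧ Interlace a (Function.update b i (b i - 1)) := by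
  have ha' := fun j => ha (Nat.le_succ j)
  have hb' := fun j => hb (Nat.le_succ j)
  simp only [Nat.succ_eq_add_one] at ha' hb'
  constructor
  · intro hi
    have hab : b i = a i + 1 := by
      by_contra hne
      refine h fun j => ?_
      have h1 := hi j
      simp only [Function.update_apply] at h1
      grind
    refine ⟨by omega, fun j => ?_⟩
    have h1 := hi j
    have h2 := ha' j
    simp only [Function.update_apply] at h1 ⊢
    grind
  · rintro ⟨hpos, hi⟩
    have hab : b i = a i + 1 := by
      by_contra hne
      refine h fun j => ?_
      have h1 := hi j
      simp only [Function.update_apply] at h1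
      grind
    intro j
    have h1 := hi j
    have h2 := hb' j
    simp only [Function.update_apply] at h1 ⊢
    grind

theorem ncard_above_eq_ncard_below_add (μ ρ : YoungDiagram) :
    {lam : YoungDiagram | (ρ ≤ lam ∧ ρ.card + 1 = lam.card) ∧ IsHorizontalStrip μ lam}.ncard =
      {ν : YoungDiagram | (ν ≤ μ ∧ ν.card + 1 = μ.card) ∧ IsHorizontalStrip ν ρ}.ncard +
        if IsHorizontalStrip μ ρ then 1 else 0 := by
  rw [ncard_above_eq, ncard_below_eq]
  split_ifs with h
  · rw [isHorizontalStrip_iff_interlace] at h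
    have hfin : {i | 0 < μ.rowLen i ∧
        Interlace ρ.rowLen (Function.update μ.rowLen i (μ.rowLen i - 1))}.Finite :=
      (Set.finite_Iio (μ.colLen 0)).subset fun i hi => rowLen_pos_iff.1 hi.1
    rw [setOf_interlace_update_of_interlace h,
      Set.ncard_insert_of_notMem (by simp) (hfin.image _),
      Set.ncard_image_of_injective _ Nat.succ_injective]
  · rw [isHorizontalStrip_iff_interlace] at h
    have hanti : ∀ ν : YoungDiagram, Antitone ν.rowLen := fun ν i j hij => ν.rowLen_anti i j hij
    simp_rw [interlace_update_iff_of_not_interlace (hanti ρ) (hanti μ) h, add_zero]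

/-! ### Standard fillings and the branching rule. -/

/-- Standard fillings of `μ` as functions on `ℕ × ℕ`, vanishing outside `μ`. -/
structure IsStandardFilling (μ : YoungDiagram) (g : ℕ × ℕ → ℕ) : Prop where
  zero : ∀ c ∉ μ, g c = 0
  bijOn : Set.BijOn g μ (Set.Iio μ.card)
  strictMonoOn : StrictMonoOn g μ

theorem strictMonoOn_of_row_col {μ : YoungDiagram} {g : ℕ × ℕ → ℕ}
    (hr : ∀ i j j', j < j' → (i, j') ∈ μ → g (i, j) < g (i, j'))
    (hc : ∀ i i' j, i < i' → (i', j) ∈ μ → g (i, j) < g (i', j)) : StrictMonoOn g μ := by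
  rintro ⟨i, j⟩ - ⟨i', j'⟩ hd hlt
  have hd' : (i', j') ∈ μ := hd
  rcases Prod.mk_lt_mk.1 hlt with ⟨hi, hj⟩ | ⟨hi, hj⟩
  · rcases hj.eq_or_lt with rfl | hj
    · exact hc _ _ _ hi hd'
    · exact (hr _ _ _ hj (μ.up_left_mem hi.le le_rfl hd')).trans (hc _ _ _ hi hd')
  · rcases hi.eq_or_lt with rfl | hi
    · exact hr _ _ _ hj hd'
    · exact (hr _ _ _ hj (μ.up_left_mem hi.le le_rfl hd')).trans (hc _ _ _ hi hd')

/-- A standard tableau as a function on `ℕ × ℕ`. -/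
def StandardTableau.filling {μ : YoungDiagram} (T : StandardTableau μ) (c : ℕ × ℕ) : ℕ :=
  if h : c ∈ μ.cells then T.entry ⟨c, h⟩ else 0

theorem StandardTableau.isStandardFilling {μ : YoungDiagram} (T : StandardTableau μ) :
    IsStandardFilling μ T.filling := by
  refine ⟨fun c hc => dif_neg hc, ⟨?_, ?_, ?_⟩, strictMonoOn_of_row_col ?_ ?_⟩
  · intro c hc
    have hc : c ∈ μ.cells := hc
    simp [filling, hc]
  · intro c hc d hd h
    have hc : c ∈ μ.cells := hc
    have hd : d ∈ μ.cells := hd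
    simp only [filling, hc, hd, dite_true] at h
    exact congrArg Subtype.val (T.entry.injective (Fin.ext h))
  · intro m hm
    refine ⟨(T.entry.symm ⟨m, hm⟩).1, (T.entry.symm ⟨m, hm⟩).2, ?_⟩
    have := (T.entry.symm ⟨m, hm⟩).2
    simp only [filling, this, dite_true, Subtype.coe_eta, Equiv.apply_symm_apply]
  · intro i j j' hlt hm
    have h1 : (i, j') ∈ μ.cells := hm
    have h2 : (i, j) ∈ μ.cells := μ.up_left_mem le_rfl hlt.le hm
    simp only [filling, h1, h2, dite_true]
    exact T.row_strict _ _ rfl hlt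
  · intro i i' j hlt hm
    have h1 : (i', j) ∈ μ.cells := hm
    have h2 : (i, j) ∈ μ.cells := μ.up_left_mem hlt.le le_rfl hm
    simp only [filling, h1, h2, dite_true]
    exact T.col_strict _ _ rfl hlt

theorem bijective_filling (μ : YoungDiagram) : Function.Bijective
    (fun T : StandardTableau μ =>
      (⟨T.filling, T.isStandardFilling⟩ : {g // IsStandardFilling μ g})) := by
  refine ⟨?_, ?_⟩
  · intro T T' h
    have he : T.entry = T'.entry := by
      ext ⟨c, hc⟩
      have := congrFun (congrArg Subtype.val h) c
      simpa only [StandardTableau.filling, hc, dite_true] using this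
    cases T; cases T'; cases he; rfl
  · rintro ⟨g, hg⟩
    have hmono : ∀ c d : {c : ℕ × ℕ // c ∈ μ.cells}, c.1 < d.1 → g c.1 < g d.1 :=
      fun c d h => hg.strictMonoOn c.2 d.2 h
    refine ⟨⟨Equiv.ofBijective (fun c => ⟨g c.1, hg.bijOn.mapsTo c.2⟩) ⟨?_, ?_⟩, ?_, ?_⟩, ?_⟩
    · intro c d h
      exact Subtype.ext (hg.bijOn.injOn c.2 d.2 (congrArg Fin.val h))
    · intro m
      obtain ⟨c, hc, h⟩ := hg.bijOn.surjOn m.2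
      exact ⟨⟨c, hc⟩, Fin.ext h⟩
    · intro c d h1 h2
      exact hmono c d (Prod.lt_iff.2 (Or.inr ⟨h1.le, h2⟩))
    · intro c d h1 h2
      exact hmono c d (Prod.lt_iff.2 (Or.inl ⟨h2, h1.le⟩))
    · refine Subtype.ext (funext fun c => ?_)
      by_cases hc : c ∈ μ.cells
      · simp only [StandardTableau.filling, hc, dite_true]
        rfl
      · simp only [StandardTableau.filling, hc, dite_false]
        exact (hg.zero c hc).symm

theorem numStandardTableaux_eq (μ : YoungDiagram) :
    numStandardTableaux μ = Nat.card {g // IsStandardFilling μ g} :=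
  Nat.card_congr (Equiv.ofBijective _ (bijective_filling μ))

theorem card_eq_succ_of_cells_eq_insert {ν lam : YoungDiagram} {c : ℕ × ℕ} (hc : c ∉ ν)
    (h : lam.cells = insert c ν.cells) : lam.card = ν.card + 1 := by
  change lam.cells.card = _
  rw [h, card_insert_of_notMem hc]

theorem coe_eq_insert_of_cells_eq_insert {ν lam : YoungDiagram} {c : ℕ × ℕ}
    (h : lam.cells = insert c ν.cells) : (lam : Set (ℕ × ℕ)) = insert c (ν : Set (ℕ × ℕ)) := by
  ext x
  change x ∈ lam.cells ↔ _
  rw [h, mem_insert]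
  rfl

theorem IsStandardFilling.update_add {ν lam : YoungDiagram} {c : ℕ × ℕ} (hc : c ∉ ν)
    (h : lam.cells = insert c ν.cells) {g : ℕ × ℕ → ℕ} (hg : IsStandardFilling ν g) :
    IsStandardFilling lam (Function.update g c ν.card) := by
  have hcoe := coe_eq_insert_of_cells_eq_insert h
  have hmem : ∀ x, x ∈ lam ↔ x = c ∨ x ∈ ν := fun x => Set.ext_iff.1 hcoe x
  have heq : Set.EqOn g (Function.update g c ν.card) ν := fun x hx => by
    rw [Function.update_of_ne]
    rintro rfl
    exact hc hx
  refine ⟨fun x hx => ?_, ?_, ?_⟩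
  · rw [hmem, not_or] at hx
    rw [Function.update_of_ne hx.1, hg.zero x hx.2]
  · rw [hcoe, card_eq_succ_of_cells_eq_insert hc h,
      show Set.Iio (ν.card + 1) = insert ν.card (Set.Iio ν.card) by ext; simp [Order.lt_add_one_iff, le_iff_eq_or_lt]]
    have := (hg.bijOn.congr heq).insert (a := c) (by simp)
    simpa using this
  · intro x hx y hy hlt
    rcases (hmem y).1 hy with rfl | hy'
    · have hx' : x ∈ ν := ((hmem x).1 hx).resolve_left hlt.ne
      rw [Function.update_self, ← heq hx']
      exact hg.bijOn.mapsTo hx'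
    · have hx' : x ∈ ν := ν.up_left_mem hlt.le.1 hlt.le.2 hy'
      rw [← heq hx', ← heq hy']
      exact hg.strictMonoOn hx' hy' hlt

theorem IsStandardFilling.exists_remove {lam : YoungDiagram} {n : ℕ} (hn : lam.card = n + 1)
    {g : ℕ × ℕ → ℕ} (hg : IsStandardFilling lam g) :
    ∃ (ν : YoungDiagram) (c : ℕ × ℕ), c ∉ ν ∧ lam.cells = insert c ν.cells ∧ g c = n ∧
      IsStandardFilling ν (Function.update g c 0) := by
  obtain ⟨c, hc, hgc⟩ := hg.bijOn.surjOn (show n ∈ Set.Iio lam.card by simp [hn])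
  have hle : ∀ x ∈ lam, g x ≤ n := fun x hx => by
    have := hg.bijOn.mapsTo hx
    simp only [Set.mem_Iio] at this
    omega
  have hlow : IsLowerSet (lam.cells.erase c : Set (ℕ × ℕ)) := by
    intro a b hba ha
    simp only [coe_erase, Set.mem_sdiff, mem_coe, Set.mem_singleton_iff] at ha ⊢
    have hb : b ∈ lam := lam.isLowerSet hba ha.1
    refine ⟨hb, ?_⟩
    rintro rfl
    have h1 := hg.strictMonoOn hb ha.1 (lt_of_le_of_ne hba (Ne.symm ha.2))
    have h2 := hle a ha.1
    omega
  have hcn : c ∉ (⟨lam.cells.erase c, hlow⟩ : YoungDiagram) := by simp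
  have hins : lam.cells = insert c (⟨lam.cells.erase c, hlow⟩ : YoungDiagram).cells :=
    (insert_erase hc).symm
  refine ⟨⟨lam.cells.erase c, hlow⟩, c, hcn, hins, hgc, ?_⟩
  have hcard := card_eq_succ_of_cells_eq_insert hcn hins
  generalize (⟨lam.cells.erase c, hlow⟩ : YoungDiagram) = ν at *
  have hcoe := coe_eq_insert_of_cells_eq_insert hins
  have hmem : ∀ x, x ∈ lam ↔ x = c ∨ x ∈ ν := fun x => Set.ext_iff.1 hcoe x
  have hsub : (ν : Set (ℕ × ℕ)) ⊆ lam := fun x hx => (hmem x).2 (Or.inr hx)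
  have heq : Set.EqOn g (Function.update g c 0) ν := fun x hx => by
    rw [Function.update_of_ne]
    rintro rfl
    exact hcn hx
  have hνn : ν.card = n := by omega
  refine ⟨fun x hx => ?_, ?_, ?_⟩
  · rw [Function.update_apply]
    split_ifs with hxc
    · rfl
    · exact hg.zero x fun h => ((hmem x).1 h).elim hxc hx
  · refine Set.BijOn.congr ⟨?_, hg.bijOn.injOn.mono hsub, ?_⟩ heq
    · intro x hx
      have h1 := hle x (hsub hx)
      have h2 : g x ≠ n := fun h => hcn (by
        rwa [← hg.bijOn.injOn (hsub hx) hc (h.trans hgc.symm)])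
      simp only [Set.mem_Iio]
      omega
    · intro m hm
      simp only [Set.mem_Iio] at hm
      obtain ⟨x, hx, hgx⟩ := hg.bijOn.surjOn (show m ∈ Set.Iio lam.card by simp; omega)
      refine ⟨x, ((hmem x).1 hx).resolve_left ?_, hgx⟩
      rintro rfl
      omega
  · exact (hg.strictMonoOn.mono hsub).congr heq

/-- Deleting the cell with the largest entry, which is `n` since entries start at 0, is inverse to
adding it. A one-cell extension is always a horizontal strip, so the condition only says that `lam`
covers `ν`. -/
theorem numStandardTableaux_eq_sum {n : ℕ} {lam : YoungDiagram} (hn : lam.card = n + 1) :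
    numStandardTableaux lam = ∑ ν ∈ partitionsOf n with IsHorizontalStrip ν lam,
      numStandardTableaux ν := by
  have hcov : ∀ ν ∈ {ν ∈ partitionsOf n | IsHorizontalStrip ν lam},
      ν.card = n ∧ ∃ c, c ∉ ν ∧ lam.cells = insert c ν.cells := fun ν hν => by
    rw [mem_filter, mem_partitionsOf] at hν
    exact ⟨hν.1, exists_cells_eq_insert (cells_subset_iff.1 hν.2.1) (by omega)⟩
  choose! hcard c hc hins using hcov
  have hfin : ∀ ν, Finite {g // IsStandardFilling ν g} := fun ν =>
    Finite.of_surjective _ (bijective_filling ν).surjective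
  simp_rw [numStandardTableaux_eq]
  rw [← Finset.sum_coe_sort, ← Nat.card_sigma]
  symm
  refine Nat.card_congr (Equiv.ofBijective (fun p =>
    ⟨Function.update p.2.1 (c p.1) p.1.1.card,
      p.2.2.update_add (hc p.1 p.1.2) (hins p.1 p.1.2)⟩) ⟨?_, ?_⟩)
  · rintro ⟨⟨ν, hν⟩, g, hg⟩ ⟨⟨ν', hν'⟩, g', hg'⟩ h
    replace h : Function.update g (c ν) ν.card = Function.update g' (c ν') ν'.card :=
      congrArg Subtype.val h
    have hl := hg.update_add (hc ν hν) (hins ν hν)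
    -- Both cells carry the entry `n` in the same filling.
    have hcc : c ν = c ν' := by
      have h1 : c ν ∈ lam.cells := by simp [hins ν hν]
      have h2 : c ν' ∈ lam.cells := by simp [hins ν' hν']
      refine hl.bijOn.injOn h1 h2 ?_
      rw [Function.update_self, h, Function.update_self, hcard ν hν, hcard ν' hν']
    have hνν : ν = ν' := by
      have h3 : c ν ∉ ν.cells := hc ν hν
      have h4 : c ν' ∉ ν'.cells := hc ν' hν'
      refine YoungDiagram.ext ?_
      rw [← erase_insert h3, ← erase_insert h4, ← hins ν hν, ← hins ν' hν', hcc]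
    subst hνν
    have hgg : g = g' := by
      funext x
      by_cases hx : x = c ν
      · rw [hx, hg.zero _ (hc ν hν), hg'.zero _ (hc ν hν)]
      · simpa [hx] using congrFun h x
    subst hgg
    rfl
  · rintro ⟨g, hg⟩
    obtain ⟨ν, d, hd, hins', hgd, hν⟩ := hg.exists_remove hn
    have hνn : ν.card = n := by
      have := card_eq_succ_of_cells_eq_insert hd hins'
      omega
    have hmem : ν ∈ {ν ∈ partitionsOf n | IsHorizontalStrip ν lam} := by
      rw [mem_filter, mem_partitionsOf, isHorizontalStrip_iff_le_of_card (by omega)]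
      exact ⟨hνn, cells_subset_iff.1 (hins' ▸ subset_insert _ _)⟩
    have hcd : c ν = d := by
      have h1 : c ν ∈ insert d ν.cells := by rw [← hins', hins ν hmem]; simp
      exact (mem_insert.1 h1).resolve_right (hc ν hmem)
    refine ⟨⟨⟨ν, hmem⟩, _, hν⟩, Subtype.ext ?_⟩
    change Function.update (Function.update g d 0) (c ν) ν.card = g
    rw [hcd, Function.update_idem, hνn, ← hgd, Function.update_eq_self]

/-! ### Weighted sums and the recurrence. -/

/-- The indicator of `lam / μ` being a horizontal strip. -/
def stripIndicator (μ lam : YoungDiagram) : ℕ := if IsHorizontalStrip μ lam then 1 else 0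

theorem sum_stripIndicator_mul (s : Finset YoungDiagram) (μ ρ : YoungDiagram) :
    ∑ lam ∈ s, stripIndicator ρ lam * stripIndicator μ lam =
      {lam | (lam ∈ s ∧ IsHorizontalStrip ρ lam) ∧ IsHorizontalStrip μ lam}.ncard := by
  have : {lam | (lam ∈ s ∧ IsHorizontalStrip ρ lam) ∧ IsHorizontalStrip μ lam} =
      ({lam ∈ s | IsHorizontalStrip ρ lam ∧ IsHorizontalStrip μ lam} : Finset YoungDiagram) := by
    ext; simp [and_assoc]
  rw [this, Set.ncard_coe_finset, card_filter]
  simp_rw [stripIndicator, ite_and, ite_mul, one_mul, zero_mul]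

theorem sum_stripIndicator_mul' (s : Finset YoungDiagram) (μ ρ : YoungDiagram) :
    ∑ ν ∈ s, stripIndicator ν μ * stripIndicator ν ρ =
      {ν | (ν ∈ s ∧ IsHorizontalStrip ν μ) ∧ IsHorizontalStrip ν ρ}.ncard := by
  have : {ν | (ν ∈ s ∧ IsHorizontalStrip ν μ) ∧ IsHorizontalStrip ν ρ} =
      ({ν ∈ s | IsHorizontalStrip ν μ ∧ IsHorizontalStrip ν ρ} : Finset YoungDiagram) := by
    ext; simp [and_assoc]
  rw [this, Set.ncard_coe_finset, card_filter]
  simp_rw [stripIndicator, ite_and, ite_mul, one_mul, zero_mul]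

theorem mem_partitionsOf_and_isHorizontalStrip_iff_above {n : ℕ} {ρ lam : YoungDiagram}
    (hρ : ρ.card = n) : lam ∈ partitionsOf (n + 1) ∧ IsHorizontalStrip ρ lam ↔
      ρ ≤ lam ∧ ρ.card + 1 = lam.card := by
  rw [mem_partitionsOf, ← hρ, eq_comm, and_comm]
  exact and_congr_left isHorizontalStrip_iff_le_of_card

theorem mem_partitionsOf_and_isHorizontalStrip_iff_below {k : ℕ} {ν μ : YoungDiagram}
    (hμ : μ.card = k + 1) : ν ∈ partitionsOf k ∧ IsHorizontalStrip ν μ ↔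
      ν ≤ μ ∧ ν.card + 1 = μ.card := by
  rw [mem_partitionsOf, hμ, Nat.add_right_cancel_iff, and_comm]
  exact and_congr_left fun h => isHorizontalStrip_iff_le_of_card (by omega)

theorem sum_above_eq_sum_below_add {k n : ℕ} {μ ρ : YoungDiagram} (hμ : μ.card = k + 1)
    (hρ : ρ.card = n) :
    ∑ lam ∈ partitionsOf (n + 1), stripIndicator ρ lam * stripIndicator μ lam =
      ∑ ν ∈ partitionsOf k, stripIndicator ν μ * stripIndicator ν ρ + stripIndicator μ ρ := by
  rw [sum_stripIndicator_mul, sum_stripIndicator_mul']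
  simp_rw [mem_partitionsOf_and_isHorizontalStrip_iff_above hρ,
    mem_partitionsOf_and_isHorizontalStrip_iff_below hμ]
  exact ncard_above_eq_ncard_below_add μ ρ

theorem sum_above_eq_of_card_eq_zero {n : ℕ} {μ ρ : YoungDiagram} (hμ : μ.card = 0)
    (hρ : ρ.card = n) :
    ∑ lam ∈ partitionsOf (n + 1), stripIndicator ρ lam * stripIndicator μ lam =
      stripIndicator μ ρ := by
  rw [sum_stripIndicator_mul]
  simp_rw [mem_partitionsOf_and_isHorizontalStrip_iff_above hρ]
  rw [ncard_above_eq_ncard_below_add μ ρ]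
  simp [hμ, stripIndicator]

theorem numStandardTableaux_eq_sum_stripIndicator {n : ℕ} {lam : YoungDiagram}
    (hn : lam ∈ partitionsOf (n + 1)) : numStandardTableaux lam =
      ∑ ν ∈ partitionsOf n, stripIndicator ν lam * numStandardTableaux ν := by
  rw [numStandardTableaux_eq_sum (mem_partitionsOf.1 hn), sum_filter]
  simp_rw [stripIndicator, ite_mul, one_mul, zero_mul]

theorem stripIndicator_self (μ : YoungDiagram) : stripIndicator μ μ = 1 :=
  if_pos ⟨Subset.rfl, by simp⟩

theorem stripIndicator_eq_zero {μ ρ : YoungDiagram} (h : μ.card = ρ.card) (hne : μ ≠ ρ) :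
    stripIndicator μ ρ = 0 :=
  if_neg fun hs => hne (YoungDiagram.ext (eq_of_subset_of_card_le hs.1 h.ge))

/-- The number of pairs of standard tableaux of shapes `μ ⊢ k` and `lam ⊢ n` such that `lam / μ` is a
horizontal strip. -/
noncomputable def stripPairCount (k n : ℕ) : ℕ :=
  ∑ μ ∈ partitionsOf k, ∑ lam ∈ partitionsOf n,
    stripIndicator μ lam * (numStandardTableaux μ * numStandardTableaux lam)

theorem sum_stripIndicator_mul_numStandardTableaux_succ (n : ℕ) (μ : YoungDiagram) :
    ∑ lam ∈ partitionsOf (n + 1), stripIndicator μ lam * numStandardTableaux lam =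
      ∑ ρ ∈ partitionsOf n, (∑ lam ∈ partitionsOf (n + 1),
        stripIndicator ρ lam * stripIndicator μ lam) * numStandardTableaux ρ := by
  simp_rw [sum_mul]
  rw [sum_comm]
  refine sum_congr rfl fun lam hlam => ?_
  rw [numStandardTableaux_eq_sum_stripIndicator hlam, mul_sum]
  exact sum_congr rfl fun ρ _ => by ring

theorem sum_stripIndicator_of_card_succ {k n : ℕ} {μ : YoungDiagram}
    (hμ : μ.card = k + 1) :
    ∑ lam ∈ partitionsOf (n + 1), stripIndicator μ lam * numStandardTableaux lam =
      ∑ ν ∈ partitionsOf k, stripIndicator ν μ *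
        ∑ ρ ∈ partitionsOf n, stripIndicator ν ρ * numStandardTableaux ρ +
      ∑ ρ ∈ partitionsOf n, stripIndicator μ ρ * numStandardTableaux ρ := by
  rw [sum_stripIndicator_mul_numStandardTableaux_succ]
  simp_rw [mul_sum]
  rw [sum_comm, ← sum_add_distrib]
  refine sum_congr rfl fun ρ hρ => ?_
  rw [sum_above_eq_sum_below_add hμ (mem_partitionsOf.1 hρ), add_mul, sum_mul]
  simp_rw [mul_assoc]

theorem sum_stripIndicator_of_card_zero {n : ℕ} {μ : YoungDiagram} (hμ : μ.card = 0) :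
    ∑ lam ∈ partitionsOf (n + 1), stripIndicator μ lam * numStandardTableaux lam =
      ∑ ρ ∈ partitionsOf n, stripIndicator μ ρ * numStandardTableaux ρ := by
  rw [sum_stripIndicator_mul_numStandardTableaux_succ]
  exact sum_congr rfl fun ρ hρ => by
    rw [sum_above_eq_of_card_eq_zero hμ (mem_partitionsOf.1 hρ)]

theorem sum_stripIndicator_of_card {k : ℕ} {μ : YoungDiagram} (hμ : μ.card = k) :
    ∑ ρ ∈ partitionsOf k, stripIndicator μ ρ * numStandardTableaux ρ =
      numStandardTableaux μ := by
  rw [sum_eq_single_of_mem μ (mem_partitionsOf.2 hμ)]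
  · rw [stripIndicator_self, one_mul]
  · intro ρ hρ hne
    rw [stripIndicator_eq_zero (hμ.trans (mem_partitionsOf.1 hρ).symm) hne.symm, zero_mul]

/-- This is the commutation relation with both diagrams of the same size: the correction term
contributes one `f^μ`, and the branching rule collects the rest into `k` copies. -/
theorem sum_cover_numStandardTableaux (k : ℕ) {μ : YoungDiagram} (hμ : μ.card = k) :
    ∑ lam ∈ partitionsOf (k + 1), stripIndicator μ lam * numStandardTableaux lam =
      (k + 1) * numStandardTableaux μ := by
  induction k generalizing μ with
  | zero => rw [sum_stripIndicator_of_card_zero hμ, sum_stripIndicator_of_card hμ]; simp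
  | succ k ih =>
    rw [sum_stripIndicator_of_card_succ hμ, sum_stripIndicator_of_card hμ,
      sum_congr rfl fun ν hν => by rw [ih (mem_partitionsOf.1 hν)],
      numStandardTableaux_eq_sum_stripIndicator (mem_partitionsOf.2 hμ), add_mul, one_mul,
      mul_sum]
    congr 1
    exact sum_congr rfl fun ν _ => by ring

theorem stripPairCount_eq (k n : ℕ) : stripPairCount k n = ∑ μ ∈ partitionsOf k,
    numStandardTableaux μ *
      ∑ lam ∈ partitionsOf n, stripIndicator μ lam * numStandardTableaux lam := by
  simp_rw [stripPairCount, mul_sum]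
  exact sum_congr rfl fun μ _ => sum_congr rfl fun lam _ => by ring

theorem stripPairCount_zero_succ (n : ℕ) : stripPairCount 0 (n + 1) = stripPairCount 0 n := by
  simp_rw [stripPairCount_eq]
  exact sum_congr rfl fun μ hμ => by
    rw [sum_stripIndicator_of_card_zero (mem_partitionsOf.1 hμ)]

theorem stripPairCount_succ_succ (k n : ℕ) : stripPairCount (k + 1) (n + 1) =
    (k + 1) * stripPairCount k n + stripPairCount (k + 1) n := by
  simp_rw [stripPairCount_eq]
  rw [sum_congr rfl fun μ hμ => by
    rw [sum_stripIndicator_of_card_succ (mem_partitionsOf.1 hμ), mul_add], sum_add_distrib]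
  congr 1
  -- The inner sum over `ρ` depends only on `ν`; summing `f^μ` over the `μ` covering `ν` gives the
  -- factor `k + 1`.
  suffices ∀ S : YoungDiagram → ℕ,
      ∑ μ ∈ partitionsOf (k + 1), numStandardTableaux μ *
        ∑ ν ∈ partitionsOf k, stripIndicator ν μ * S ν =
      (k + 1) * ∑ ν ∈ partitionsOf k, numStandardTableaux ν * S ν from this _
  intro S
  simp_rw [mul_sum]
  rw [sum_comm]
  refine sum_congr rfl fun ν hν => ?_
  rw [← mul_assoc, ← sum_cover_numStandardTableaux k (mem_partitionsOf.1 hν), sum_mul]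
  exact sum_congr rfl fun μ _ => by ring

/-! ### Initial values and comparison with the falling factorial. -/

theorem partitionsOf_zero : partitionsOf 0 = {⊥} := by
  ext μ
  rw [mem_partitionsOf, mem_singleton]
  change μ.cells.card = 0 ↔ _
  rw [card_eq_zero, ← cells_bot]
  exact ⟨fun h => YoungDiagram.ext h, fun h => h ▸ rfl⟩

theorem numStandardTableaux_bot : numStandardTableaux ⊥ = 1 := by
  rw [numStandardTableaux, Nat.card_eq_one_iff_exists]
  have : IsEmpty {c : ℕ × ℕ // c ∈ (⊥ : YoungDiagram).cells} := ⟨fun c => notMem_empty _ c.2⟩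
  have : IsEmpty (Fin (⊥ : YoungDiagram).card) := by
    change IsEmpty (Fin 0)
    infer_instance
  refine ⟨⟨Equiv.equivOfIsEmpty _ _, fun c => isEmptyElim c, fun c => isEmptyElim c⟩, ?_⟩
  rintro ⟨e, _, _⟩
  congr 1
  exact Subsingleton.elim _ _

theorem stripPairCount_zero_zero : stripPairCount 0 0 = 1 := by
  rw [stripPairCount_eq, partitionsOf_zero, sum_singleton, ← partitionsOf_zero,
    sum_stripIndicator_of_card (k := 0) rfl, numStandardTableaux_bot]

theorem stripPairCount_succ_zero (k : ℕ) : stripPairCount (k + 1) 0 = 0 := by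
  rw [stripPairCount, partitionsOf_zero]
  refine sum_eq_zero fun μ hμ => ?_
  rw [sum_singleton, stripIndicator, if_neg, zero_mul]
  intro h
  have h1 := card_le_card h.1
  have h2 : μ.cells.card = k + 1 := mem_partitionsOf.1 hμ
  simp [h2] at h1

theorem stripPairCount_eq_descFactorial (k n : ℕ) : stripPairCount k n = n.descFactorial k := by
  induction n generalizing k with
  | zero =>
    cases k with
    | zero => exact stripPairCount_zero_zero
    | succ k => rw [stripPairCount_succ_zero, Nat.zero_descFactorial_succ]
  | succ n ih =>
    cases k with
    | zero => rw [stripPairCount_zero_succ, ih]; simp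
    | succ k =>
      rw [stripPairCount_succ_succ, ih, ih, Nat.succ_descFactorial_succ,
        Nat.descFactorial_succ, ← add_mul]
      -- The coefficients satisfy `(k + 1) + (n - k) = n + 1` only for `k ≤ n`, subtraction being
      -- truncated; otherwise the common factor vanishes.
      rcases le_or_gt k n with h | h
      · congr 1
        omega
      · simp [Nat.descFactorial_eq_zero_iff_lt.2 h]

end YoungDiagram

theorem mainTheorem2 (k n : ℕ) :
    (k ≤ n →
      (Nat.factorial n : ℚ) / (Nat.factorial (n - k) : ℚ) = (Fintype.card (Fin k ↪ Fin n) : ℚ)) ∧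
    Fintype.card (Fin k ↪ Fin n) =
      ∑ p ∈ YoungDiagram.partitionsOf k ×ˢ YoungDiagram.partitionsOf n with
          YoungDiagram.IsHorizontalStrip p.1 p.2,
        YoungDiagram.numStandardTableaux p.1 * YoungDiagram.numStandardTableaux p.2 := by
  rw [Fintype.card_embedding_eq, Fintype.card_fin, Fintype.card_fin]
  constructor
  · intro h
    rw [div_eq_iff (by exact_mod_cast Nat.factorial_ne_zero _), mul_comm]
    exact_mod_cast (Nat.factorial_mul_descFactorial h).symm
  · rw [← YoungDiagram.stripPairCount_eq_descFactorial, YoungDiagram.stripPairCount,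
      Finset.sum_filter, Finset.sum_product]
    simp_rw [YoungDiagram.stripIndicator, ite_mul, one_mul, zero_mul]
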